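/- Let $(M,g)$ be a smooth $m$-dimensional Riemannian manifold with Levi-Civita connection $\nabla$, let ${\mathcal D}\subseteq TM$ be a smooth distribution of rank $n+1$, let ${\mathcal F}$ be an $n$-dimensional smooth foliation of $M$ (that is, $T{\mathcal F}$ is a smooth integrable distribution of rank $n$) with $T{\mathcal F}\subseteq{\mathcal D}$, and let $N$ be a smooth unit vector field tangent to ${\mathcal D}$ and orthogonal to $T{\mathcal F}$, so that ${\mathcal D}=T{\mathcal F}\oplus{\rm span}(N)$. Let $P:TM\to{\mathcal D}$ and $^\top:TM\to T{\mathcal F}$ be the orthogonal projections. For sections $V$ of ${\mathcal D}$ and $Y$ of $T{\mathcal F}$ put $\nabla^P_XV=P\nabla_XV$ and $\nabla^{\mathcal F}_XY=(\nabla_XY)^\top$, and let $$R^P(X,Y)V=\nabla^P_X\nabla^P_YV-\nabla^P_Y\nabla^P_XV-\nabla^P_{[X,Y]}V .$$ Let $A:T{\mathcal F}\to T{\mathcal F}$, $AX=-\nabla^P_XN$, be the shape operator, let $\sigma_r$ be defined by $\det({\rm id}_{T{\mathcal F}}+tA)=\sum_{r}\sigma_rt^r$ (so $\sigma_r=0$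 for $r>n$), and let $T_0(A)={\rm id}_{T{\mathcal F}}$, $T_r(A)=\sigma_r\,{\rm id}_{T{\mathcal F}}-A\,T_{r-1}(A)$ for $r\ge1$. For a vector field $X$ tangent to ${\mathcal F}$ let ${\mathcal R}^P_X:T{\mathcal F}\to T{\mathcal F}$, ${\mathcal R}^P_XV=R^P(V,X)N$. For a field $B$ of endomorphisms of $T{\mathcal F}$ let $(\nabla^{\mathcal F}_XB)Y=\nabla^{\mathcal F}_X(BY)-B\nabla^{\mathcal F}_XY$ and ${\rm div}_{\mathcal F}B=\sum_{i=1}^n(\nabla^{\mathcal F}_{e_i}B)e_i$, and let ${\rm tr}_{\mathcal F}L=\sum_{i=1}^n\langle Le_i,e_i\rangle$, where $(e_i)$ is any smooth local orthonormal frame of $T{\mathcal F}$. **Proposition.** One has ${\rm div}_{\mathcal F}T_0(A)=0$, and for every integer $r>0$ and every smooth vector field $X$ tangent to ${\mathcal F}$ $$\langle{\rm div}_{\mathcal F}T_r(A),X\rangle=-\langle{\rm div}_{\mathcal F}T_{r-1}(A),AX\rangle+{\rm tr}_{\mathcal F}\big(T_{r-1}(A)\,{\mathcal R}^P_X\big).$$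 Equivalently, for every integer $r>0$ and every such $X$, $$\langle{\rm div}_{\mathcal F}T_r(A),X\rangle=\sum_{j=1}^{r}(-1)^{j-1}\,{\rm tr}_{\mathcal F}\big(T_{r-j}(A)\,{\mathcal R}^P_{A^{j-1}X}\big).$$ -/

import Mathlib

open Bundle
open scoped Manifold ContDiff Topology

noncomputable section

namespace FoliatedSubRiemannian

/-- Elementary symmetric functions of an endomorphism: `sigma r A` is the coefficient of `t ^ r` in
`det (id + t A)`, the determinant being computed in a basis (see `det_one_add_smul`). -/
def sigma {V : Type*} [AddCommGroup V] [Module ℝ V] [FiniteDimensional ℝ V]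
    (r : ℕ) (A : Module.End ℝ V) : ℝ :=
  (1 + (Polynomial.X : Polynomial ℝ) •
    (LinearMap.toMatrix (Module.finBasis ℝ V) (Module.finBasis ℝ V) A).map Polynomial.C).det.coeff r

/-- The defining identity `det (id + t A) = ∑ r, σ_r t ^ r` of the `σ_r`. -/
theorem det_one_add_smul {V : Type*} [AddCommGroup V] [Module ℝ V] [FiniteDimensional ℝ V]
    (A : Module.End ℝ V) (t : ℝ) :
    LinearMap.det (1 + t • A) =
      ∑ r ∈ Finset.range (Module.finrank ℝ V + 1), sigma r A * t ^ r := by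
  set b := Module.finBasis ℝ V
  set B := LinearMap.toMatrix b b A with hB
  have hdeg : (1 + (Polynomial.X : Polynomial ℝ) • B.map Polynomial.C).det.natDegree < Module.finrank ℝ V + 1 := by
    have h := Polynomial.natDegree_det_X_add_C_le B (1 : Matrix _ _ ℝ)
    rw [Matrix.map_one Polynomial.C Polynomial.C_0 Polynomial.C_1, Fintype.card_fin, add_comm] at h
    exact Nat.lt_succ_of_le h
  have h1 : LinearMap.det (1 + t • A) = (1 + (Polynomial.X : Polynomial ℝ) • B.map Polynomial.C).det.eval t := by
    rw [← LinearMap.det_toMatrix b, map_add, map_smul, LinearMap.toMatrix_one, ← hB,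
      ← Polynomial.coe_evalRingHom, RingHom.map_det]
    congr 1
    ext i j
    by_cases hij : i = j <;> simp [hij, mul_comm t]
  rw [h1, Polynomial.eval_eq_sum_range' hdeg]
  rfl

/-- Newton transformations: `T_0 = id`, `T_r = σ_r id - A T_{r-1}`. -/
def newton {V : Type*} [AddCommGroup V] [Module ℝ V] [FiniteDimensional ℝ V]
    (A : Module.End ℝ V) : ℕ → Module.End ℝ V
  | 0 => 1
  | r + 1 => sigma (r + 1) A • 1 - A * newton A r

variable {m : ℕ} {M : Type*} [TopologicalSpace M] [ChartedSpace (EuclideanSpace ℝ (Fin m)) M]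

instance instFiniteDimensionalTangentSpace (x : M) :
    FiniteDimensional ℝ (TangentSpace (𝓡 m) x) :=
  inferInstanceAs (FiniteDimensional ℝ (EuclideanSpace ℝ (Fin m)))

/-- The vector field `X` is smooth on the set `U`. -/
def SmoothOn [IsManifold (𝓡 m) ∞ M] (X : ∀ x : M, TangentSpace (𝓡 m) x) (U : Set M) : Prop :=
  ContMDiffOn (𝓡 m) (𝓡 m).tangent ∞
    (fun x ↦ TotalSpace.mk' (EuclideanSpace ℝ (Fin m)) x (X x)) U

/-- `D` is a smooth distribution (subbundle of `TM`) of rank `k`: near every point it is spanned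
by `k` pointwise linearly independent smooth vector fields. -/
def IsDistribution [IsManifold (𝓡 m) ∞ M] (k : ℕ)
    (D : ∀ x : M, Submodule ℝ (TangentSpace (𝓡 m) x)) : Prop :=
  ∀ x : M, ∃ U : Set M, IsOpen U ∧ x ∈ U ∧ ∃ s : Fin k → ∀ y : M, TangentSpace (𝓡 m) y,
    (∀ i, SmoothOn (s i) U) ∧
    ∀ y ∈ U, LinearIndependent ℝ (fun i ↦ s i y) ∧
      Submodule.span ℝ (Set.range fun i ↦ s i y) = D y

theorem finrank_of_isDistribution [IsManifold (𝓡 m) ∞ M] {k : ℕ} {D : ∀ x : M, Submodule ℝ (TangentSpace (𝓡 m) x)}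
    (h : IsDistribution k D) (x : M) : Module.finrank ℝ (D x) = k := by
  obtain ⟨U, -, hx, s, -, hs⟩ := h x
  obtain ⟨h1, h2⟩ := hs x hx
  rw [← h2, finrank_span_eq_card h1, Fintype.card_fin]

/-- `D` is integrable: the Lie bracket of any two (local) vector fields tangent to `D` is tangent
to `D`. -/
def IsIntegrable [IsManifold (𝓡 m) ∞ M]
    (D : ∀ x : M, Submodule ℝ (TangentSpace (𝓡 m) x)) : Prop :=
  ∀ (U : Set M) (X Y : ∀ x : M, TangentSpace (𝓡 m) x), IsOpen U → SmoothOn X U → SmoothOn Y U →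
    (∀ x ∈ U, X x ∈ D x) → (∀ x ∈ U, Y x ∈ D x) →
    ∀ x ∈ U, VectorField.mlieBracket (𝓡 m) X Y x ∈ D x

variable [IsManifold (𝓡 m) ∞ M]
  [RiemannianBundle (fun x : M ↦ TangentSpace (𝓡 m) x)]

instance instIsContMDiffRiemannianBundleOne
    [h : IsContMDiffRiemannianBundle (𝓡 m) ∞ (EuclideanSpace ℝ (Fin m))
      (fun x : M ↦ TangentSpace (𝓡 m) x)] :
    IsContMDiffRiemannianBundle (𝓡 m) 1 (EuclideanSpace ℝ (Fin m))
      (fun x : M ↦ TangentSpace (𝓡 m) x) :=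
  IsContMDiffRiemannianBundle.of_le (n := ∞) (by simp)

variable (m M) in
/-- The Levi-Civita connection: a smooth linear connection on `TM` that is torsion-free and
compatible with the Riemannian metric. `toFun Y x v` is `∇_v Y` at `x`. -/
structure LeviCivita
    [IsContMDiffRiemannianBundle (𝓡 m) ∞ (EuclideanSpace ℝ (Fin m))
      (fun x : M ↦ TangentSpace (𝓡 m) x)]
    extends CovariantDerivative (𝓡 m) (EuclideanSpace ℝ (Fin m))
      (fun x : M ↦ TangentSpace (𝓡 m) x) where
  smooth : ∀ U : Set M, IsOpen U →
    ContMDiffCovariantDerivativeOn (EuclideanSpace ℝ (Fin m)) ∞ toFun U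
  torsion_free : toCovariantDerivative.torsion = 0
  metric : toCovariantDerivative.IsMetricCompatible

variable (m M) in
/-- A codimension-one foliated sub-Riemannian structure on the Riemannian manifold `M`: a
distribution `D` of rank `n + 1`, the tangent distribution `TF ⊆ D` of an `n`-dimensional
foliation, and a unit vector field `N` tangent to `D` and orthogonal to `TF`, so that
`D = TF ⊕ span N`. -/
structure Structure (n : ℕ) where
  D : ∀ x : M, Submodule ℝ (TangentSpace (𝓡 m) x)
  TF : ∀ x : M, Submodule ℝ (TangentSpace (𝓡 m) x)
  N : ∀ x : M, TangentSpace (𝓡 m) x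
  isDistribution_D : IsDistribution (n + 1) D
  isDistribution_TF : IsDistribution n TF
  isIntegrable_TF : IsIntegrable TF
  TF_le_D : ∀ x, TF x ≤ D x
  smooth_N : SmoothOn N Set.univ
  N_mem_D : ∀ x, N x ∈ D x
  norm_N : ∀ x, ‖N x‖ = 1
  N_orthogonal : ∀ x, ∀ v ∈ TF x, inner ℝ v (N x) = 0

namespace Structure

variable {n : ℕ} (S : Structure m M n)

/-- The orthoprojector `P : TM → D`. -/
def P (x : M) : TangentSpace (𝓡 m) x →L[ℝ] TangentSpace (𝓡 m) x :=
  (S.D x).starProjection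

/-- The orthoprojector `TM → TF`. -/
def projF (x : M) : TangentSpace (𝓡 m) x →L[ℝ] S.TF x :=
  (S.TF x).orthogonalProjectionOnto

/-- `D = TF ⊕ span N`: a vector of `D` orthogonal to `N` is tangent to `F`. -/
theorem mem_TF_of_orthogonal (x : M) {u : TangentSpace (𝓡 m) x} (hu : u ∈ S.D x)
    (huN : inner ℝ u (S.N x) = 0) : u ∈ S.TF x := by
  have hNN : inner ℝ (S.N x) (S.N x) = (1 : ℝ) := by
    rw [real_inner_self_eq_norm_sq, S.norm_N, one_pow]
  have hN : S.N x ∉ S.TF x := fun h ↦ by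
    have := S.N_orthogonal x _ h
    rw [hNN] at this
    exact one_ne_zero this
  have hle : S.TF x ⊔ Submodule.span ℝ {S.N x} ≤ S.D x :=
    sup_le (S.TF_le_D x) ((Submodule.span_singleton_le_iff_mem _ _).2 (S.N_mem_D x))
  have hlt : S.TF x < S.TF x ⊔ Submodule.span ℝ {S.N x} := by
    refine lt_of_le_of_ne le_sup_left fun h ↦ hN ?_
    rw [h]
    exact Submodule.mem_sup_right (Submodule.mem_span_singleton_self _)
  have h1 := Submodule.finrank_lt_finrank_of_lt hlt
  rw [finrank_of_isDistribution S.isDistribution_TF x] at h1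
  have heq := Submodule.eq_of_le_of_finrank_le hle
    (by rw [finrank_of_isDistribution S.isDistribution_D x]; exact h1)
  rw [← heq, Submodule.mem_sup] at hu
  obtain ⟨t, ht, w, hw, rfl⟩ := hu
  obtain ⟨c, rfl⟩ := Submodule.mem_span_singleton.1 hw
  rw [inner_add_left, S.N_orthogonal x t ht, real_inner_smul_left, hNN] at huN
  have hc : c = 0 := by linarith
  simpa [hc] using ht

variable [IsContMDiffRiemannianBundle (𝓡 m) ∞ (EuclideanSpace ℝ (Fin m))
    (fun x : M ↦ TangentSpace (𝓡 m) x)] (nabla : LeviCivita m M)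

/-- The induced connection `∇^P_X V = P ∇_X V` on sections `V` of `D`. -/
def nablaP (X V : ∀ x : M, TangentSpace (𝓡 m) x) : ∀ x : M, TangentSpace (𝓡 m) x :=
  fun x ↦ S.P x (nabla.toFun V x (X x))

/-- The curvature of the induced connection,
`R^P(X, Y) V = ∇^P_X ∇^P_Y V - ∇^P_Y ∇^P_X V - ∇^P_{[X, Y]} V`. -/
def curvP (X Y V : ∀ x : M, TangentSpace (𝓡 m) x) : ∀ x : M, TangentSpace (𝓡 m) x :=
  S.nablaP nabla X (S.nablaP nabla Y V) - S.nablaP nabla Y (S.nablaP nabla X V) -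
    S.nablaP nabla (VectorField.mlieBracket (𝓡 m) X Y) V

/-- `P ∇_v N` is tangent to `F`, because `N` has constant length. -/
theorem P_nabla_N_mem (x : M) (v : TangentSpace (𝓡 m) x) :
    S.P x (nabla.toFun S.N x v) ∈ S.TF x := by
  refine S.mem_TF_of_orthogonal x ((S.D x).starProjection_apply_mem _) ?_
  have hP : S.P x (S.N x) = S.N x := Submodule.starProjection_eq_self_iff.2 (S.N_mem_D x)
  have hsymm : inner ℝ (S.P x (nabla.toFun S.N x v)) (S.N x) =
      inner ℝ (nabla.toFun S.N x v) (S.N x) := by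
    rw [P, Submodule.inner_starProjection_left_eq_right]
    exact congrArg _ hP
  rw [hsymm]
  have hN : MDifferentiableAt (𝓡 m) (𝓡 m).tangent
      (fun x ↦ TotalSpace.mk' (EuclideanSpace ℝ (Fin m)) x (S.N x)) x :=
    (S.smooth_N.contMDiffAt Filter.univ_mem).mdifferentiableAt (by simp)
  have h := nabla.metric.mvfderiv_inner_eq
    (FiberBundle.extend (EuclideanSpace ℝ (Fin m)) v) hN hN
  have hconst : (fun y : M ↦ inner ℝ (S.N y) (S.N y)) = fun _ ↦ (1 : ℝ) := by
    funext y
    rw [real_inner_self_eq_norm_sq, S.norm_N, one_pow]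
  rw [hconst] at h
  simp only [FiberBundle.extend_apply_self] at h
  rw [real_inner_comm (nabla.toFun S.N x v)] at h
  have h0 : mvfderiv (𝓡 m) (fun _ : M ↦ (1 : ℝ)) x v = 0 := by simp [mvfderiv]
  rw [h0] at h
  linarith

/-- The shape operator `A : T_x F → T_x F`, `A v = - ∇^P_v N`. -/
def shape (x : M) : Module.End ℝ (S.TF x) :=
  -((S.P x ∘L nabla.toFun S.N x).toLinearMap.comp (S.TF x).subtype).codRestrict (S.TF x)
    (fun v ↦ S.P_nabla_N_mem nabla x v)

/-- The Newton transformation `T_r(A)` of the shape operator at `x`. -/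
def T (r : ℕ) (x : M) : Module.End ℝ (S.TF x) := newton (S.shape nabla x) r

/-- The connection induced on `TF`: `∇^F_X Y` is the `TF`-component of `∇_X Y`. -/
def nablaF (X Y : ∀ x : M, S.TF x) : ∀ x : M, S.TF x :=
  fun x ↦ S.projF x (nabla.toFun (fun y ↦ (Y y : TangentSpace (𝓡 m) y)) x (X x))

/-- The covariant derivative of a field `B` of endomorphisms of `TF`:
`(∇^F_X B) Y = ∇^F_X (B Y) - B (∇^F_X Y)`. -/
def nablaEnd (X : ∀ x : M, S.TF x) (B : ∀ x : M, Module.End ℝ (S.TF x)) (Y : ∀ x : M, S.TF x) :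
    ∀ x : M, S.TF x :=
  fun x ↦ S.nablaF nabla X (fun y ↦ B y (Y y)) x - B x (S.nablaF nabla X Y x)

/-- `e` is a smooth orthonormal frame of `TF` on `U`. -/
structure IsFrame (e : Fin n → ∀ x : M, S.TF x) (U : Set M) : Prop where
  smooth : ∀ i, SmoothOn (fun x ↦ (e i x : TangentSpace (𝓡 m) x)) U
  orthonormal : ∀ x ∈ U, Orthonormal ℝ (fun i ↦ e i x)

/-- The leafwise divergence `∑ i, (∇^F_{e_i} B) e_i`, computed in the frame `e`. -/
def divF (e : Fin n → ∀ x : M, S.TF x) (B : ∀ x : M, Module.End ℝ (S.TF x)) (x : M) : S.TF x :=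
  ∑ i, S.nablaEnd nabla (e i) B (e i) x

/-- The operator `V ↦ R^P(V, X) N` on sections `V` of `TF`. As `R^P(V, X)` is skew-symmetric,
`R^P(V, X) N` is a section of `TF`; the projection records this in its type. -/
def curvOp (X V : ∀ x : M, S.TF x) : ∀ x : M, S.TF x :=
  fun x ↦ S.projF x (S.curvP nabla (fun y ↦ (V y : TangentSpace (𝓡 m) y))
    (fun y ↦ (X y : TangentSpace (𝓡 m) y)) S.N x)

/-- The trace `∑ i, ⟨L e_i, e_i⟩` over `TF` at `x`, in the frame `e`, of an operator `L` on
sections of `TF`. -/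
def trF (e : Fin n → ∀ x : M, S.TF x) (L : (∀ x : M, S.TF x) → ∀ x : M, S.TF x) (x : M) : ℝ :=
  ∑ i, inner ℝ (L (e i) x) (e i x)

end Structure

end FoliatedSubRiemannian

end

/-! Differentiate the recursion `T_{r+1} = σ_{r+1} id - A T_r` along `v`. Jacobi's formula gives
`v(σ_{r+1}) = tr (T_r ∇_v A)`, because the coefficients of `adj (1 + tA)` are the Newton
transformations. Hence `∇_v T_{r+1} = tr (T_r ∇_v A) id - (∇_v A) T_r - A ∇_v T_r`. Put `v = e_i`,
apply to `e_i`, pair with `X` and sum over `i`. As `A` is symmetric, the last term becomes `-⟨div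
T_r, AX⟩`. As `T_r` and every `∇_{e_i} A` are symmetric, the other two combine to the pairing of
`T_r` with `(∇_X A) e_i - (∇_{e_i} A) X`. The Codazzi equation identifies that difference with
`R^P(e_i, X) N`, which gives the recursion. Iterating it with `X` replaced by `AX` gives the closed
formula.

Geometry enters in two places: integrability of `TF` makes `A` symmetric, and it makes `[V, X]`
tangent to `F` in Codazzi (`IsFrame.curvOp_eq`). Everything else is matrix algebra in an orthonormal
frame, where `∇_v B` has matrix `dB(v) + [ω(v), B]` with `ω` skew (`IsFrame.inner_nablaEnd`,
`IsFrame.covMatrix_T_succ`, `sum_divergence_step`).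

Polynomial matrix expressions are differentiated through dual numbers. A first-order jet is a ring
homomorphism to `DualNumber ℝ`, so identities over an arbitrary commutative ring with an element of
square zero become derivative formulas. -/

noncomputable section

namespace FoliatedSubRiemannian

/-! ### Newton transformations of matrices over a commutative ring. -/

section MatrixAlgebra

variable {ι : Type*} [Fintype ι] [DecidableEq ι] {R : Type*} [CommRing R]

/-- The coefficient of `t ^ r` in `det (1 + t B)`, for a matrix over a commutative ring. -/
def sigmaMatrix (r : ℕ) (B : Matrix ι ι R) : R :=
  (1 + (Polynomial.X : Polynomial R) • B.map Polynomial.C).det.coeff r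

/-- The Newton transformations of a matrix over a commutative ring. -/
def newtonMatrix (B : Matrix ι ι R) : ℕ → Matrix ι ι R
  | 0 => 1
  | r + 1 => sigmaMatrix (r + 1) B • 1 - B * newtonMatrix B r

theorem map_sigmaMatrix {R' : Type*} [CommRing R'] (φ : R →+* R') (r : ℕ) (B : Matrix ι ι R) :
    φ (sigmaMatrix r B) = sigmaMatrix r (B.map φ) := by
  rw [sigmaMatrix, sigmaMatrix, ← Polynomial.coeff_map, ← Polynomial.coe_mapRingHom,
    RingHom.map_det]
  congr 2
  ext1 i j
  by_cases hij : i = j <;> simp [hij]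

theorem map_newtonMatrix {R' : Type*} [CommRing R'] (φ : R →+* R') (B : Matrix ι ι R) (r : ℕ) :
    (newtonMatrix B r).map φ = newtonMatrix (B.map φ) r := by
  induction r with
  | zero => simp [newtonMatrix]
  | succ r ih =>
    rw [newtonMatrix, newtonMatrix, ← ih, ← map_sigmaMatrix, Matrix.map_sub _ (map_sub φ),
      Matrix.map_mul]
    congr 1
    ext i j
    by_cases hij : i = j <;> simp [hij]

/-- With `Q = 1 + X B`, the identity `Q adj Q = det Q` reads `adj Q = det Q - X B adj Q`. Comparing
coefficients of `X ^ (r + 1)` gives the recursion that defines `newtonMatrix`. -/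
theorem coeff_adjugate (B : Matrix ι ι R) (r : ℕ) :
    (1 + (Polynomial.X : Polynomial R) • B.map Polynomial.C).adjugate.map (fun p ↦ p.coeff r) =
      newtonMatrix B r := by
  set Q := 1 + (Polynomial.X : Polynomial R) • B.map Polynomial.C with hQ
  have h := Q.mul_adjugate
  have hadj : Q.adjugate = Q.det • 1 - (Polynomial.X : Polynomial R) •
      (B.map Polynomial.C * Q.adjugate) := by
    rw [← h]
    nth_rewrite 2 [hQ]
    rw [add_mul, one_mul, Matrix.smul_mul, add_sub_cancel_right]
  induction r with
  | zero =>
    have hdet : Q.det.coeff 0 = 1 := by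
      rw [Polynomial.coeff_zero_eq_eval_zero, ← Polynomial.coe_evalRingHom, RingHom.map_det]
      have h1 : (Polynomial.evalRingHom 0).mapMatrix Q = 1 := by
        ext i j
        by_cases hij : i = j
        · subst hij; simp [hQ]
        · simp [hij, hQ]
      rw [h1, Matrix.det_one]
    rw [hadj]
    ext i j
    by_cases hij : i = j
    · subst hij; simp [hdet, newtonMatrix]
    · simp [hij, newtonMatrix]
  | succ r ih =>
    rw [hadj, newtonMatrix, ← ih]
    ext i j
    by_cases hij : i = j <;> simp [hij, sigmaMatrix, hQ, Matrix.mul_apply]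

/-- Jacobi's formula to first order. -/
theorem det_add_smul_of_sq_zero (P Q : Matrix ι ι R) {e : R} (he : e * e = 0) :
    (P + e • Q).det = P.det + e * (P.adjugate * Q).trace := by
  -- Since `e ^ 2 = 0`, only the terms with at most one factor `e` survive in the product.
  have hprod : ∀ (s : Finset ι) (p q : ι → R),
      ∏ i ∈ s, (p i + e * q i) = ∏ i ∈ s, p i + e * ∑ j ∈ s, q j * ∏ i ∈ s.erase j, p i := by
    intro s p q
    induction s using Finset.induction_on with
    | empty => simp
    | insert k s hk ih =>
      have h1 : ∑ j ∈ s, q j * ∏ i ∈ (insert k s).erase j, p i =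
          p k * ∑ j ∈ s, q j * ∏ i ∈ s.erase j, p i := by
        rw [Finset.mul_sum]
        refine Finset.sum_congr rfl fun j hj ↦ ?_
        have hjk : k ≠ j := fun h ↦ hk (h ▸ hj)
        rw [Finset.erase_insert_of_ne hjk, Finset.prod_insert (by simp [hk])]
        ring
      rw [Finset.prod_insert hk, Finset.prod_insert hk, Finset.sum_insert hk,
        Finset.erase_insert hk, ih, h1]
      linear_combination (q k * ∑ j ∈ s, q j * ∏ i ∈ s.erase j, p i) * he
  -- By Cramer's rule, the `j`-th diagonal entry is the determinant of `P` with its `j`-th column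
  -- replaced by that of `Q`; the Leibniz formula expands it.
  have htr : (P.adjugate * Q).trace =
      ∑ j, ∑ σ : Equiv.Perm ι, ((Equiv.Perm.sign σ : ℤ) : R) *
        (Q (σ j) j * ∏ i ∈ Finset.univ.erase j, P (σ i) i) := by
    rw [Matrix.trace]
    refine Finset.sum_congr rfl fun j _ ↦ ?_
    have h1 : (P.adjugate * Q).diag j = (P.adjugate.mulVec fun k ↦ Q k j) j := rfl
    rw [h1, ← Matrix.cramer_eq_adjugate_mulVec, Matrix.cramer_apply, Matrix.det_apply']
    refine Finset.sum_congr rfl fun σ _ ↦ ?_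
    rw [← Finset.mul_prod_erase _ _ (Finset.mem_univ j), Matrix.updateCol_self]
    congr 2
    refine Finset.prod_congr rfl fun i hi ↦ ?_
    rw [Matrix.updateCol_ne (Finset.ne_of_mem_erase hi)]
  rw [htr, Finset.sum_comm, Matrix.det_apply', Matrix.det_apply', Finset.mul_sum,
    ← Finset.sum_add_distrib]
  refine Finset.sum_congr rfl fun σ _ ↦ ?_
  have h2 := hprod Finset.univ (fun i ↦ P (σ i) i) fun i ↦ Q (σ i) i
  simp only [Matrix.add_apply, Matrix.smul_apply, smul_eq_mul]
  rw [h2, ← Finset.mul_sum]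
  ring

/-- The first-order variation of `σ_{r+1}` is `tr (T_r Q)`. -/
theorem sigmaMatrix_add_smul_of_sq_zero (P Q : Matrix ι ι R) {e : R} (he : e * e = 0) (r : ℕ) :
    sigmaMatrix (r + 1) (P + e • Q) =
      sigmaMatrix (r + 1) P + e * (newtonMatrix P r * Q).trace := by
  have h1 : 1 + (Polynomial.X : Polynomial R) • (P + e • Q).map Polynomial.C =
      (1 + (Polynomial.X : Polynomial R) • P.map Polynomial.C) +
        Polynomial.C e • ((Polynomial.X : Polynomial R) • Q.map Polynomial.C) := by
    ext1 i j
    simp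
    ring
  -- The perturbation carries a factor `X`, so the coefficient `r + 1` of the determinant sees the
  -- coefficient `r` of the adjugate, which is `T_r`.
  rw [sigmaMatrix, h1, det_add_smul_of_sq_zero _ _ (by rw [← Polynomial.C_mul, he, map_zero]),
    ← coeff_adjugate]
  simp [sigmaMatrix, Matrix.trace, Matrix.mul_apply, Polynomial.finsetSum_coeff,
    ← Finset.mul_sum]

theorem newtonMatrix_commute (B : Matrix ι ι R) (r : ℕ) :
    B * newtonMatrix B r = newtonMatrix B r * B := by
  induction r with
  | zero => simp [newtonMatrix]
  | succ r ih => rw [newtonMatrix, mul_sub, sub_mul, ih, ← mul_assoc, ih]; simp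

theorem transpose_newtonMatrix {B : Matrix ι ι R} (hB : B.transpose = B) (r : ℕ) :
    (newtonMatrix B r).transpose = newtonMatrix B r := by
  induction r with
  | zero => simp [newtonMatrix]
  | succ r ih =>
    rw [newtonMatrix, Matrix.transpose_sub, Matrix.transpose_mul, ih, hB, newtonMatrix_commute]
    simp

end MatrixAlgebra

/-! ### From endomorphisms to their matrices in an arbitrary basis. -/

section Endomorphism

variable {ι : Type*} [Fintype ι] [DecidableEq ι]
  {V : Type*} [AddCommGroup V] [Module ℝ V]

theorem eval_det_one_add (b : Module.Basis ι ℝ V) (A : Module.End ℝ V) (t : ℝ) :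
    (1 + (Polynomial.X : Polynomial ℝ) •
      (LinearMap.toMatrix b b A).map Polynomial.C).det.eval t = LinearMap.det (1 + t • A) := by
  rw [← LinearMap.det_toMatrix b, map_add, map_smul, LinearMap.toMatrix_one,
    ← Polynomial.coe_evalRingHom, RingHom.map_det]
  congr 1
  ext i j
  by_cases hij : i = j <;> simp [hij, mul_comm t]

/-- At each real `t` both polynomials take the basis-free value `det (1 + tA)`, and a real
polynomial is determined by its values. This permits the use of an orthonormal frame in place of
`Module.finBasis`. -/
theorem sigma_eq_sigmaMatrix [FiniteDimensional ℝ V] (b : Module.Basis ι ℝ V)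
    (A : Module.End ℝ V) (r : ℕ) :
    sigma r A = sigmaMatrix r (LinearMap.toMatrix b b A) := by
  rw [sigma, sigmaMatrix]
  congr 1
  refine Polynomial.funext fun t ↦ ?_
  rw [eval_det_one_add, eval_det_one_add]

theorem toMatrix_newton [FiniteDimensional ℝ V] (b : Module.Basis ι ℝ V)
    (A : Module.End ℝ V) (r : ℕ) :
    LinearMap.toMatrix b b (newton A r) = newtonMatrix (LinearMap.toMatrix b b A) r := by
  induction r with
  | zero => rw [newton, newtonMatrix, LinearMap.toMatrix_one]
  | succ r ih =>
    rw [newton, newtonMatrix, map_sub, map_smul, LinearMap.toMatrix_mul, ih,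
      LinearMap.toMatrix_one, sigma_eq_sigmaMatrix b]

end Endomorphism

/-! ### Index computation behind the divergence recursion. -/

section DivergenceAlgebra

variable {ι : Type*} [Fintype ι] [DecidableEq ι]

/-- The algebraic core of the recursion for the divergence of the Newton transformations. -/
theorem sum_divergence_step (a t : Matrix ι ι ℝ) (Da F E : ι → Matrix ι ι ℝ) (ξ : ι → ℝ)
    (ha : a.transpose = a) (ht : t.transpose = t) (hDa : ∀ i, (Da i).transpose = Da i)
    (hE : ∀ i, E i = (t * Da i).trace • 1 - Da i * t - a * F i) :
    ∑ l, ξ l * ∑ i, E i l i =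
      -∑ l, a.mulVec ξ l * ∑ i, F i l i +
        ∑ i, ∑ l, t i l * (∑ k, ξ k * Da k l i - (Da i).mulVec ξ l) := by
  have ha' : ∀ i j, a i j = a j i := fun i j ↦ congrFun (congrFun ha j) i
  have ht' : ∀ i j, t i j = t j i := fun i j ↦ congrFun (congrFun ht j) i
  have hD' : ∀ k i j, Da k i j = Da k j i := fun k i j ↦ congrFun (congrFun (hDa k) j) i
  have h0 : ∑ l, ξ l * ∑ i, E i l i = ∑ i, ξ i * (t * Da i).trace
      - ∑ l, ξ l * ∑ i, (Da i * t) l i - ∑ l, ξ l * ∑ i, (a * F i) l i := by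
    rw [← Finset.sum_sub_distrib, ← Finset.sum_sub_distrib]
    refine Finset.sum_congr rfl fun l _ ↦ ?_
    simp only [hE, Matrix.sub_apply, Finset.sum_sub_distrib, Matrix.smul_apply, Matrix.one_apply,
      smul_eq_mul, mul_ite, mul_one, mul_zero, Finset.sum_ite_eq, Finset.mem_univ, if_true]
    ring
  -- Symmetry of `a` moves it onto `ξ`.
  have h1 : ∑ l, ξ l * ∑ i, (a * F i) l i = ∑ l, a.mulVec ξ l * ∑ i, F i l i := by
    simp only [Matrix.mul_apply, Matrix.mulVec, dotProduct, Finset.mul_sum, Finset.sum_mul]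
    rw [Finset.sum_comm]
    rw [Finset.sum_comm (s := Finset.univ) (t := Finset.univ)
      (f := fun l i ↦ ∑ k, a l k * ξ k * F i l i)]
    refine Finset.sum_congr rfl fun i _ ↦ ?_
    rw [Finset.sum_comm]
    refine Finset.sum_congr rfl fun l _ ↦ Finset.sum_congr rfl fun k _ ↦ ?_
    rw [ha' l k]; ring
  -- Symmetry of both `t` and `Da i` is used here.
  have h2 : ∑ l, ξ l * ∑ i, (Da i * t) l i = ∑ i, ∑ l, t i l * (Da i).mulVec ξ l := by
    simp only [Matrix.mul_apply, Matrix.mulVec, dotProduct, Finset.mul_sum]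
    rw [Finset.sum_comm]
    refine Finset.sum_congr rfl fun i _ ↦ ?_
    rw [Finset.sum_comm]
    refine Finset.sum_congr rfl fun l _ ↦ Finset.sum_congr rfl fun k _ ↦ ?_
    rw [ht' i l, hD' i l k]; ring
  have h3 : ∑ i, ξ i * (t * Da i).trace = ∑ i, ∑ l, t i l * ∑ k, ξ k * Da k l i := by
    simp only [Matrix.trace, Matrix.diag, Matrix.mul_apply, Finset.mul_sum]
    rw [Finset.sum_comm]
    refine Finset.sum_congr rfl fun i _ ↦ ?_
    rw [Finset.sum_comm]
    refine Finset.sum_congr rfl fun l _ ↦ Finset.sum_congr rfl fun k _ ↦ ?_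
    ring
  simp only [mul_sub, Finset.sum_sub_distrib]
  rw [h0, h1, h2, h3]
  ring

end DivergenceAlgebra

/-! ### Differentiating matrix-valued functions through dual numbers. -/

section MatrixFunctions

variable {m : ℕ} {M : Type*} [TopologicalSpace M] [ChartedSpace (EuclideanSpace ℝ (Fin m)) M]
  {ι : Type*} [Fintype ι] [DecidableEq ι]

variable (m) in
/-- The ring of real functions differentiable at `x`. -/
def differentiableSubring (x : M) : Subring (M → ℝ) where
  carrier := {f | MDifferentiableAt (𝓡 m) 𝓘(ℝ, ℝ) f x}
  mul_mem' hf hg := hf.mul hg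
  one_mem' := mdifferentiableAt_const
  add_mem' hf hg := hf.add hg
  zero_mem' := mdifferentiableAt_const
  neg_mem' hf := hf.neg

/-- The first-order jet of a function at `x` along `v`, as a dual number. -/
def jet (x : M) (v : TangentSpace (𝓡 m) x) : differentiableSubring m x →+* DualNumber ℝ where
  toFun f := TrivSqZeroExt.inl (f.1 x) + TrivSqZeroExt.inr (mvfderiv (𝓡 m) f.1 x v)
  map_one' := by
    have h := DFunLike.congr_fun (mvfderiv_const (I := 𝓡 m) (1 : ℝ) (x := x)) v
    ext
    · simp
    · simpa using! h
  map_zero' := by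
    ext <;> simp
  map_add' f g := by
    have h := DFunLike.congr_fun (mvfderiv_add f.2 g.2) v
    ext
    · simp
    · simpa using h
  map_mul' f g := by
    have h := DFunLike.congr_fun (mvfderiv_mul f.2 g.2) v
    ext
    · simp
    · simpa [mul_comm] using h

@[simp]
theorem fst_jet (x : M) (v : TangentSpace (𝓡 m) x) (f : differentiableSubring m x) :
    (jet x v f).fst = f.1 x := by
  simp [jet]

@[simp]
theorem snd_jet (x : M) (v : TangentSpace (𝓡 m) x) (f : differentiableSubring m x) :
    (jet x v f).snd = mvfderiv (𝓡 m) f.1 x v := by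
  simp [jet]

/-- Evaluation at `y` of functions differentiable at `x`. -/
def evalAt (x y : M) : differentiableSubring m x →+* ℝ :=
  (Pi.evalRingHom (fun _ : M ↦ ℝ) y).comp (differentiableSubring m x).subtype

/-- A matrix-valued function differentiable at `x`, as a matrix over the ring of such functions. -/
def liftMatrix {x : M} (a : M → Matrix ι ι ℝ)
    (ha : ∀ i j, MDifferentiableAt (𝓡 m) 𝓘(ℝ, ℝ) (fun y ↦ a y i j) x) :
    Matrix ι ι (differentiableSubring m x) :=
  Matrix.of fun i j ↦ ⟨fun y ↦ a y i j, ha i j⟩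

/-- The entrywise derivative at `x` of a matrix-valued function. -/
def matrixDeriv (a : M → Matrix ι ι ℝ) (x : M) (v : TangentSpace (𝓡 m) x) : Matrix ι ι ℝ :=
  Matrix.of fun i j ↦ mvfderiv (𝓡 m) (fun y ↦ a y i j) x v

variable {x : M} {a : M → Matrix ι ι ℝ}

/-- Evaluation at `y` is a ring homomorphism, so `σ_r` formed in the ring of functions is the
pointwise one. Differentiability then comes from membership in `differentiableSubring`. -/
theorem coe_sigmaMatrix_liftMatrix
    (ha : ∀ i j, MDifferentiableAt (𝓡 m) 𝓘(ℝ, ℝ) (fun y ↦ a y i j) x) (r : ℕ) :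
    (sigmaMatrix r (liftMatrix a ha)).1 = fun y ↦ sigmaMatrix r (a y) := by
  funext y
  exact map_sigmaMatrix (evalAt x y) r (liftMatrix a ha)

theorem coe_newtonMatrix_liftMatrix
    (ha : ∀ i j, MDifferentiableAt (𝓡 m) 𝓘(ℝ, ℝ) (fun y ↦ a y i j) x) (r : ℕ) (i j : ι) :
    (newtonMatrix (liftMatrix a ha) r i j).1 = fun y ↦ newtonMatrix (a y) r i j := by
  funext y
  exact congrFun (congrFun (map_newtonMatrix (evalAt x y) (liftMatrix a ha) r) i) j

theorem mdifferentiableAt_sigmaMatrix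
    (ha : ∀ i j, MDifferentiableAt (𝓡 m) 𝓘(ℝ, ℝ) (fun y ↦ a y i j) x) (r : ℕ) :
    MDifferentiableAt (𝓡 m) 𝓘(ℝ, ℝ) (fun y ↦ sigmaMatrix r (a y)) x :=
  coe_sigmaMatrix_liftMatrix ha r ▸ (sigmaMatrix r (liftMatrix a ha)).2

theorem mdifferentiableAt_newtonMatrix
    (ha : ∀ i j, MDifferentiableAt (𝓡 m) 𝓘(ℝ, ℝ) (fun y ↦ a y i j) x) (r : ℕ) (i j : ι) :
    MDifferentiableAt (𝓡 m) 𝓘(ℝ, ℝ) (fun y ↦ newtonMatrix (a y) r i j) x :=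
  coe_newtonMatrix_liftMatrix ha r i j ▸ (newtonMatrix (liftMatrix a ha) r i j).2

/-- The jet of `a` is `a + ε a'` with `ε ^ 2 = 0`; the `ε`-part of the first-order expansion of
`σ_{r+1}` is the derivative. -/
theorem mvfderiv_sigmaMatrix
    (ha : ∀ i j, MDifferentiableAt (𝓡 m) 𝓘(ℝ, ℝ) (fun y ↦ a y i j) x) (r : ℕ)
    (v : TangentSpace (𝓡 m) x) :
    mvfderiv (𝓡 m) (fun y ↦ sigmaMatrix (r + 1) (a y)) x v =
      (newtonMatrix (a x) r * matrixDeriv a x v).trace := by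
  set φ : ℝ →+* DualNumber ℝ := TrivSqZeroExt.inlHom ℝ ℝ with hφ
  have h1 : (liftMatrix a ha).map (jet x v) =
      (a x).map φ + (DualNumber.eps : DualNumber ℝ) • (matrixDeriv a x v).map φ := by
    ext i j
    · simp [liftMatrix, hφ]
    · simp [liftMatrix, hφ, matrixDeriv]
  have h2 := map_sigmaMatrix (jet x v) (r + 1) (liftMatrix a ha)
  rw [h1, sigmaMatrix_add_smul_of_sq_zero _ _ DualNumber.eps_mul_eps, ← map_sigmaMatrix,
    ← map_newtonMatrix, ← Matrix.map_mul, ← AddMonoidHom.map_trace] at h2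
  have h3 := congrArg TrivSqZeroExt.snd h2
  rw [snd_jet, coe_sigmaMatrix_liftMatrix ha] at h3
  rw [h3]
  simp [hφ]

theorem mvfderiv_congr_of_eventuallyEq {f g : M → ℝ} (h : f =ᶠ[𝓝 x] g)
    (v : TangentSpace (𝓡 m) x) : mvfderiv (𝓡 m) f x v = mvfderiv (𝓡 m) g x v := by
  rw [mvfderiv, mvfderiv, h.mfderiv_eq]
  rfl

omit [DecidableEq ι] in
theorem coe_sum_mul {f g : ι → M → ℝ}
    (hf : ∀ i, MDifferentiableAt (𝓡 m) 𝓘(ℝ, ℝ) (f i) x)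
    (hg : ∀ i, MDifferentiableAt (𝓡 m) 𝓘(ℝ, ℝ) (g i) x) :
    (∑ i, (⟨f i, hf i⟩ * ⟨g i, hg i⟩ : differentiableSubring m x)).1 =
      fun y ↦ ∑ i, f i y * g i y := by
  funext y
  exact (map_sum (evalAt x y) _ _).trans (Finset.sum_congr rfl fun i _ ↦ rfl)

omit [DecidableEq ι] in
theorem mdifferentiableAt_sum_mul {f g : ι → M → ℝ}
    (hf : ∀ i, MDifferentiableAt (𝓡 m) 𝓘(ℝ, ℝ) (f i) x)
    (hg : ∀ i, MDifferentiableAt (𝓡 m) 𝓘(ℝ, ℝ) (g i) x) :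
    MDifferentiableAt (𝓡 m) 𝓘(ℝ, ℝ) (fun y ↦ ∑ i, f i y * g i y) x := by
  rw [← coe_sum_mul hf hg]
  exact (∑ i, (⟨f i, hf i⟩ * ⟨g i, hg i⟩ : differentiableSubring m x)).2

omit [DecidableEq ι] in
theorem mvfderiv_sum_mul {f g : ι → M → ℝ}
    (hf : ∀ i, MDifferentiableAt (𝓡 m) 𝓘(ℝ, ℝ) (f i) x)
    (hg : ∀ i, MDifferentiableAt (𝓡 m) 𝓘(ℝ, ℝ) (g i) x) (v : TangentSpace (𝓡 m) x) :
    mvfderiv (𝓡 m) (fun y ↦ ∑ i, f i y * g i y) x v =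
      ∑ i, (mvfderiv (𝓡 m) (f i) x v * g i x + f i x * mvfderiv (𝓡 m) (g i) x v) := by
  have h := congrArg TrivSqZeroExt.snd (map_sum (jet x v)
    (fun i ↦ (⟨f i, hf i⟩ * ⟨g i, hg i⟩ : differentiableSubring m x)) Finset.univ)
  rw [snd_jet, coe_sum_mul hf hg] at h
  rw [h, TrivSqZeroExt.snd_sum]
  refine Finset.sum_congr rfl fun i _ ↦ ?_
  simp
  ring

omit [DecidableEq ι] in
theorem matrixDeriv_mul {b : M → Matrix ι ι ℝ}
    (ha : ∀ i j, MDifferentiableAt (𝓡 m) 𝓘(ℝ, ℝ) (fun y ↦ a y i j) x)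
    (hb : ∀ i j, MDifferentiableAt (𝓡 m) 𝓘(ℝ, ℝ) (fun y ↦ b y i j) x)
    (v : TangentSpace (𝓡 m) x) :
    matrixDeriv (fun y ↦ a y * b y) x v =
      matrixDeriv a x v * b x + a x * matrixDeriv b x v := by
  ext i j
  simp only [matrixDeriv, Matrix.of_apply, Matrix.mul_apply, Matrix.add_apply]
  rw [mvfderiv_sum_mul (fun k ↦ ha i k) (fun k ↦ hb k j), Finset.sum_add_distrib]

theorem matrixDeriv_newtonMatrix_succ
    (ha : ∀ i j, MDifferentiableAt (𝓡 m) 𝓘(ℝ, ℝ) (fun y ↦ a y i j) x) (r : ℕ)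
    (v : TangentSpace (𝓡 m) x) :
    matrixDeriv (fun y ↦ newtonMatrix (a y) (r + 1)) x v =
      (newtonMatrix (a x) r * matrixDeriv a x v).trace • 1 -
        (matrixDeriv a x v * newtonMatrix (a x) r +
          a x * matrixDeriv (fun y ↦ newtonMatrix (a y) r) x v) := by
  have hT := mdifferentiableAt_newtonMatrix ha r
  rw [← matrixDeriv_mul ha hT, ← mvfderiv_sigmaMatrix ha]
  have hmul : ∀ i j, MDifferentiableAt (𝓡 m) 𝓘(ℝ, ℝ)
      (fun y ↦ (a y * newtonMatrix (a y) r) i j) x := fun i j ↦ by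
    simp only [Matrix.mul_apply]
    exact mdifferentiableAt_sum_mul (fun k ↦ ha i k) fun k ↦ hT k j
  ext i j
  have hone : MDifferentiableAt (𝓡 m) 𝓘(ℝ, ℝ) (fun _ : M ↦ (1 : Matrix ι ι ℝ) i j) x :=
    mdifferentiableAt_const
  have hs := mdifferentiableAt_sigmaMatrix ha (r + 1)
  have h1 := DFunLike.congr_fun (mvfderiv_fun_sub (hs.mul hone) (hmul i j)) v
  have h2 := DFunLike.congr_fun (mvfderiv_fun_mul hs hone) v
  rw [mvfderiv_const] at h2
  refine h1.trans ?_
  simp only [Matrix.sub_apply, Matrix.smul_apply, smul_eq_mul]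
  rw [sub_apply]
  congr 1
  refine h2.trans ?_
  simp [mul_comm]

end MatrixFunctions

/-! ### Rules for the Levi-Civita connection and symmetry of the shape operator. -/

section LeviCivitaCalculus

variable {m : ℕ} {M : Type*} [TopologicalSpace M] [ChartedSpace (EuclideanSpace ℝ (Fin m)) M]
  [IsManifold (𝓡 m) ∞ M]

/-- The vector field `X` is differentiable at `x`. -/
abbrev FieldDiffAt (X : ∀ x : M, TangentSpace (𝓡 m) x) (x : M) : Prop :=
  MDifferentiableAt (𝓡 m) (𝓡 m).tangent
    (fun y ↦ TotalSpace.mk' (EuclideanSpace ℝ (Fin m)) y (X y)) x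

theorem SmoothOn.mdifferentiableAt {X : ∀ x : M, TangentSpace (𝓡 m) x} {U : Set M}
    (hX : SmoothOn X U) (hU : IsOpen U) {x : M} (hx : x ∈ U) : FieldDiffAt X x :=
  ((hX x hx).contMDiffAt (hU.mem_nhds hx)).mdifferentiableAt (by simp)

theorem mdifferentiableAt_sum_smul {ι : Type*} [Fintype ι] {x : M} {f : ι → M → ℝ}
    {s : ι → ∀ y : M, TangentSpace (𝓡 m) y}
    (hf : ∀ k, MDifferentiableAt (𝓡 m) 𝓘(ℝ, ℝ) (f k) x) (hs : ∀ k, FieldDiffAt (s k) x) :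
    FieldDiffAt ((fun y ↦ ∑ k, f k y • s k y)) x :=
  MDifferentiableAt.sum_section (s := Finset.univ) fun k _ ↦ (hf k).smul_section (hs k)

variable [RiemannianBundle (fun x : M ↦ TangentSpace (𝓡 m) x)]
  [IsContMDiffRiemannianBundle (𝓡 m) ∞ (EuclideanSpace ℝ (Fin m))
    (fun x : M ↦ TangentSpace (𝓡 m) x)]

namespace LeviCivita

variable (nabla : LeviCivita m M)

theorem congr_of_eventuallyEq {Y Y' : ∀ x : M, TangentSpace (𝓡 m) x} {x : M}
    (hY : FieldDiffAt Y x) (hY' : FieldDiffAt (Y') x) (h : ∀ᶠ y in 𝓝 x, Y y = Y' y) :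
    nabla.toFun Y x = nabla.toFun Y' x :=
  nabla.isCovariantDerivativeOnUniv.congr_of_eventuallyEq hY hY' Filter.univ_mem h

theorem toFun_sum_smul {ι : Type*} [Fintype ι] {x : M} {f : ι → M → ℝ}
    {s : ι → ∀ y : M, TangentSpace (𝓡 m) y}
    (hf : ∀ k, MDifferentiableAt (𝓡 m) 𝓘(ℝ, ℝ) (f k) x) (hs : ∀ k, FieldDiffAt (s k) x)
    (v : TangentSpace (𝓡 m) x) :
    nabla.toFun (fun y ↦ ∑ k, f k y • s k y) x v =
      ∑ k, (f k x • nabla.toFun (s k) x v + mvfderiv (𝓡 m) (f k) x v • s k x) := by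
  classical
  have key : ∀ t : Finset ι, nabla.toFun (fun y ↦ ∑ k ∈ t, f k y • s k y) x =
      ∑ k ∈ t, (f k x • nabla.toFun (s k) x + (mvfderiv (𝓡 m) (f k) x).smulRight (s k x)) := by
    intro t
    induction t using Finset.induction_on with
    | empty =>
      have h := nabla.isCovariantDerivativeOnUniv.zero (Set.mem_univ x)
      simp only [Finset.sum_empty]
      exact h
    | insert k t hk ih =>
      have h1 : (fun y ↦ ∑ k ∈ insert k t, f k y • s k y) =
          (f k • s k) + fun y ↦ ∑ k ∈ t, f k y • s k y := by
        funext y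
        simp [Finset.sum_insert hk]
      have h2 : FieldDiffAt (fun y ↦ ∑ k ∈ t, f k y • s k y) x :=
        MDifferentiableAt.sum_section (s := t) fun k _ ↦ (hf k).smul_section (hs k)
      rw [h1, nabla.isCovariantDerivativeOnUniv.add ((hf k).smul_section (hs k)) h2
        (Set.mem_univ x), nabla.isCovariantDerivativeOnUniv.leibniz (hs k) (hf k)
        (Set.mem_univ x), ih, Finset.sum_insert hk]
  rw [key]
  simp

theorem toFun_neg {x : M} {Y : ∀ y : M, TangentSpace (𝓡 m) y} (hY : FieldDiffAt Y x) :
    nabla.toFun (fun y ↦ -Y y) x = -nabla.toFun Y x := by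
  have h := nabla.isCovariantDerivativeOnUniv.smul_const (-1 : ℝ) hY (Set.mem_univ x)
  have h1 : (-1 : ℝ) • Y = fun y ↦ -Y y := by
    funext y
    simp
  rw [h1] at h
  rw [h, neg_one_smul]

theorem mvfderiv_inner {x : M} {Y Z : ∀ y : M, TangentSpace (𝓡 m) y}
    (hY : FieldDiffAt Y x) (hZ : FieldDiffAt Z x) (v : TangentSpace (𝓡 m) x) :
    mvfderiv (𝓡 m) (fun y ↦ inner ℝ (Y y) (Z y)) x v =
      inner ℝ (nabla.toFun Y x v) (Z x) + inner ℝ (Y x) (nabla.toFun Z x v) := by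
  have h := nabla.metric.mvfderiv_inner_eq (FiberBundle.extend (EuclideanSpace ℝ (Fin m)) v) hY hZ
  simpa only [FiberBundle.extend_apply_self] using h

theorem mlieBracket_eq {x : M} {X Y : ∀ y : M, TangentSpace (𝓡 m) y}
    (hX : FieldDiffAt X x) (hY : FieldDiffAt Y x) :
    VectorField.mlieBracket (𝓡 m) X Y x = nabla.toFun Y x (X x) - nabla.toFun X x (Y x) :=
  (nabla.toCovariantDerivative.torsion_eq_zero_iff.1 nabla.torsion_free hX hY).symm

theorem smoothOn_toFun {X Y : ∀ y : M, TangentSpace (𝓡 m) y} {U : Set M} (hU : IsOpen U)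
    (hX : SmoothOn X U) (hY : SmoothOn Y U) : SmoothOn (fun y ↦ nabla.toFun Y y (X y)) U :=
  ContMDiffOn.clm_bundle_apply ((nabla.smooth U hU).contMDiff (by simpa using! hY)) hX

end LeviCivita

namespace Structure

variable {n : ℕ} (S : Structure m M n) (nabla : LeviCivita m M)

omit [IsContMDiffRiemannianBundle (𝓡 m) ∞ (EuclideanSpace ℝ (Fin m))
    (fun x : M ↦ TangentSpace (𝓡 m) x)] in
theorem inner_projF (x : M) (w : TangentSpace (𝓡 m) x) (u : S.TF x) :
    inner ℝ (S.projF x w) u = inner ℝ w (u : TangentSpace (𝓡 m) x) :=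
  Submodule.inner_orthogonalProjectionOnto_eq_of_mem_right u w

omit [IsContMDiffRiemannianBundle (𝓡 m) ∞ (EuclideanSpace ℝ (Fin m))
    (fun x : M ↦ TangentSpace (𝓡 m) x)] in
theorem projF_coe (x : M) (u : S.TF x) : S.projF x (u : TangentSpace (𝓡 m) x) = u :=
  Submodule.orthogonalProjectionOnto_mem_subspace_eq_self u

omit [IsContMDiffRiemannianBundle (𝓡 m) ∞ (EuclideanSpace ℝ (Fin m))
    (fun x : M ↦ TangentSpace (𝓡 m) x)] in
-- Because `TF ⊆ D`, the projector `P` disappears once the `TF`-component is taken.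
theorem projF_P (x : M) (w : TangentSpace (𝓡 m) x) : S.projF x (S.P x w) = S.projF x w := by
  refine ext_inner_right ℝ fun u ↦ ?_
  rw [inner_projF, inner_projF, P, Submodule.inner_starProjection_left_eq_right]
  exact congrArg _ (Submodule.starProjection_eq_self_iff.2 (S.TF_le_D x u.2))

theorem coe_shape (x : M) (v : S.TF x) :
    (S.shape nabla x v : TangentSpace (𝓡 m) x) = -S.P x (nabla.toFun S.N x v) :=
  rfl

theorem shape_eq (x : M) (v : S.TF x) :
    S.shape nabla x v = -S.projF x (nabla.toFun S.N x v) := by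
  rw [← S.projF_coe x (S.shape nabla x v), coe_shape, map_neg, projF_P]

theorem inner_shape (x : M) (u v : S.TF x) :
    inner ℝ (S.shape nabla x v) u =
      -inner ℝ (nabla.toFun S.N x v) (u : TangentSpace (𝓡 m) x) := by
  rw [shape_eq, inner_neg_left, inner_projF]

/-- The shape operator is symmetric on smooth sections, by integrability of `TF`. -/
theorem inner_shape_comm {U : Set M} (hU : IsOpen U) {X Y : ∀ x : M, S.TF x}
    (hX : SmoothOn (fun x ↦ (X x : TangentSpace (𝓡 m) x)) U)
    (hY : SmoothOn (fun x ↦ (Y x : TangentSpace (𝓡 m) x)) U) {x : M} (hx : x ∈ U) :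
    inner ℝ (S.shape nabla x (X x)) (Y x) = inner ℝ (S.shape nabla x (Y x)) (X x) := by
  have hXd := hX.mdifferentiableAt hU hx
  have hYd := hY.mdifferentiableAt hU hx
  have hN : FieldDiffAt (S.N) x := S.smooth_N.mdifferentiableAt isOpen_univ (Set.mem_univ x)
  -- Differentiating `⟨Z, N⟩ = 0` moves the derivative from `N` to `Z`; the asymmetry of `A` is then
  -- the `N`-component of `[X, Y]`, which vanishes by integrability.
  have key : ∀ Z W : ∀ x : M, S.TF x,
      FieldDiffAt ((fun y ↦ (Z y : TangentSpace (𝓡 m) y))) x →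
      inner ℝ (S.shape nabla x (W x)) (Z x) =
        inner ℝ (nabla.toFun (fun y ↦ (Z y : TangentSpace (𝓡 m) y)) x (W x)) (S.N x) := by
    intro Z W hZ
    have h := nabla.mvfderiv_inner hZ hN (W x : TangentSpace (𝓡 m) x)
    have h0 : (fun y ↦ inner ℝ (Z y : TangentSpace (𝓡 m) y) (S.N y)) = fun _ ↦ (0 : ℝ) := by
      funext y
      exact S.N_orthogonal y _ (Z y).2
    rw [h0, mvfderiv_const] at h
    rw [inner_shape, real_inner_comm]
    have h1 : (0 : TangentSpace (𝓡 m) x →L[ℝ] ℝ) (W x : TangentSpace (𝓡 m) x) = 0 := rfl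
    linarith
  have hbr := S.N_orthogonal x _ (S.isIntegrable_TF U _ _ hU hX hY (fun y _ ↦ (X y).2)
    (fun y _ ↦ (Y y).2) x hx)
  rw [nabla.mlieBracket_eq hXd hYd, inner_sub_left] at hbr
  rw [key Y X hYd, key X Y hXd]
  linarith

end Structure

end LeviCivitaCalculus

/-! ### Covariant derivatives in an orthonormal frame of `TF`. -/

section FrameCalculus

variable {m : ℕ} {M : Type*} [TopologicalSpace M] [ChartedSpace (EuclideanSpace ℝ (Fin m)) M]
  [IsManifold (𝓡 m) ∞ M] [RiemannianBundle (fun x : M ↦ TangentSpace (𝓡 m) x)]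

namespace Structure

variable {n : ℕ} {S : Structure m M n} {e : Fin n → ∀ x : M, S.TF x} {U : Set M}

/-- The orthonormal basis of `TF` at `y` given by a frame. -/
def IsFrame.basis (he : S.IsFrame e U) {y : M} (hy : y ∈ U) :
    OrthonormalBasis (Fin n) ℝ (S.TF y) :=
  OrthonormalBasis.mk (he.orthonormal y hy)
    (((he.orthonormal y hy).linearIndependent.span_eq_top_of_card_eq_finrank'
      (by rw [Fintype.card_fin, finrank_of_isDistribution S.isDistribution_TF])).ge)

theorem IsFrame.basis_apply (he : S.IsFrame e U) {y : M} (hy : y ∈ U) (i : Fin n) :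
    he.basis hy i = e i y := by
  simp [IsFrame.basis]

theorem IsFrame.sum_inner_smul (he : S.IsFrame e U) {y : M} (hy : y ∈ U) (u : S.TF y) :
    ∑ i, (inner ℝ u (e i y) : ℝ) • e i y = u := by
  have h := (he.basis hy).sum_repr' u
  simp only [he.basis_apply] at h
  refine Eq.trans ?_ h
  exact Finset.sum_congr rfl fun i _ ↦ by rw [real_inner_comm]

theorem IsFrame.coe_eq_sum (he : S.IsFrame e U) {y : M} (hy : y ∈ U) (u : S.TF y) :
    (u : TangentSpace (𝓡 m) y) =
      ∑ i, (inner ℝ u (e i y) : ℝ) • (e i y : TangentSpace (𝓡 m) y) := by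
  have h := congrArg Subtype.val (he.sum_inner_smul hy u)
  rw [← h]
  simp

theorem IsFrame.sum_inner_mul_inner (he : S.IsFrame e U) {y : M} (hy : y ∈ U) (u v : S.TF y) :
    ∑ i, inner ℝ u (e i y) * inner ℝ v (e i y) = inner ℝ u v := by
  have h := (he.basis hy).sum_inner_mul_inner u v
  simp only [he.basis_apply] at h
  rw [← h]
  exact Finset.sum_congr rfl fun i _ ↦ by rw [real_inner_comm (e i y) v]

/-- The matrix of a field of endomorphisms of `TF` in a frame. -/
def frameMatrix (e : Fin n → ∀ x : M, S.TF x) (B : ∀ x : M, Module.End ℝ (S.TF x)) (y : M) :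
    Matrix (Fin n) (Fin n) ℝ :=
  Matrix.of fun i j ↦ inner ℝ (B y (e j y)) (e i y)

theorem IsFrame.toMatrix_eq (he : S.IsFrame e U) (B : ∀ x : M, Module.End ℝ (S.TF x)) {y : M}
    (hy : y ∈ U) :
    LinearMap.toMatrix (he.basis hy).toBasis (he.basis hy).toBasis (B y) = frameMatrix e B y := by
  ext i j
  rw [LinearMap.toMatrix_apply, OrthonormalBasis.coe_toBasis,
    OrthonormalBasis.coe_toBasis_repr_apply, OrthonormalBasis.repr_apply_apply, he.basis_apply, he.basis_apply, real_inner_comm]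
  rfl

theorem IsFrame.inner_apply (he : S.IsFrame e U) (B : ∀ x : M, Module.End ℝ (S.TF x)) {y : M}
    (hy : y ∈ U) (u : S.TF y) (i : Fin n) :
    inner ℝ (B y u) (e i y) = (frameMatrix e B y).mulVec (fun k ↦ inner ℝ u (e k y)) i := by
  conv_lhs => rw [← he.sum_inner_smul hy u]
  rw [map_sum, sum_inner]
  refine Finset.sum_congr rfl fun k _ ↦ ?_
  rw [map_smul]
  exact (real_inner_smul_left (B y (e k y)) (e i y) _).trans (mul_comm _ _)

theorem IsFrame.fieldDiffAt (he : S.IsFrame e U) (hU : IsOpen U) {x : M} (hx : x ∈ U)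
    {Y : ∀ x : M, S.TF x}
    (hf : ∀ k, MDifferentiableAt (𝓡 m) 𝓘(ℝ, ℝ) (fun y ↦ inner ℝ (Y y) (e k y)) x) :
    FieldDiffAt (fun x ↦ (Y x : TangentSpace (𝓡 m) x)) x := by
  have h := mdifferentiableAt_sum_smul hf fun k ↦ (he.smooth k).mdifferentiableAt hU hx
  refine h.congr_of_eventuallyEq ?_
  filter_upwards [hU.mem_nhds hx] with y hy
  rw [he.coe_eq_sum hy (Y y)]

theorem IsFrame.smoothOn_of_inner (he : S.IsFrame e U) {Y : ∀ x : M, S.TF x}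
    (hf : ∀ k, ContMDiffOn (𝓡 m) 𝓘(ℝ, ℝ) ∞ (fun y ↦ inner ℝ (Y y) (e k y)) U) :
    SmoothOn (fun x ↦ (Y x : TangentSpace (𝓡 m) x)) U := by
  have h := ContMDiffOn.sum_section (s := Finset.univ) fun k _ ↦ (hf k).smul_section (he.smooth k)
  refine h.congr fun y hy ↦ ?_
  exact congrArg (TotalSpace.mk' (EuclideanSpace ℝ (Fin m)) y) (he.coe_eq_sum hy (Y y))

variable [IsContMDiffRiemannianBundle (𝓡 m) ∞ (EuclideanSpace ℝ (Fin m))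
    (fun x : M ↦ TangentSpace (𝓡 m) x)] (nabla : LeviCivita m M)

theorem IsFrame.frameMatrix_T (he : S.IsFrame e U) (r : ℕ) {y : M} (hy : y ∈ U) :
    frameMatrix e (S.T nabla r) y = newtonMatrix (frameMatrix e (S.shape nabla) y) r := by
  rw [← he.toMatrix_eq _ hy, ← he.toMatrix_eq _ hy, T, toMatrix_newton]

theorem mdifferentiableAt_inner {X Y : ∀ x : M, S.TF x} {x : M}
    (hX : FieldDiffAt (fun x ↦ (X x : TangentSpace (𝓡 m) x)) x)
    (hY : FieldDiffAt (fun x ↦ (Y x : TangentSpace (𝓡 m) x)) x) :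
    MDifferentiableAt (𝓡 m) 𝓘(ℝ, ℝ) (fun y ↦ inner ℝ (X y) (Y y)) x :=
  hX.inner_bundle hY

/-- The frame coefficients are `-⟨∇_X N, e_k⟩`, free of `P`, so smoothness of the orthoprojectors is
not needed. -/
theorem IsFrame.smoothOn_shape (he : S.IsFrame e U) (hU : IsOpen U) {X : ∀ x : M, S.TF x}
    (hX : SmoothOn (fun x ↦ (X x : TangentSpace (𝓡 m) x)) U) :
    SmoothOn (fun x ↦ (S.shape nabla x (X x) : TangentSpace (𝓡 m) x)) U := by
  refine he.smoothOn_of_inner fun k ↦ ?_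
  simp only [inner_shape]
  exact ((nabla.smoothOn_toFun hU hX (S.smooth_N.mono (Set.subset_univ U))).inner_bundle
    (he.smooth k)).neg

theorem IsFrame.mdifferentiableAt_frameMatrix_shape (he : S.IsFrame e U) (hU : IsOpen U) {x : M}
    (hx : x ∈ U) (i j : Fin n) :
    MDifferentiableAt (𝓡 m) 𝓘(ℝ, ℝ) (fun y ↦ frameMatrix e (S.shape nabla) y i j) x :=
  mdifferentiableAt_inner ((he.smoothOn_shape nabla hU (he.smooth j)).mdifferentiableAt hU hx)
    ((he.smooth i).mdifferentiableAt hU hx)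

theorem IsFrame.mdifferentiableAt_frameMatrix_T (he : S.IsFrame e U) (hU : IsOpen U) {x : M}
    (hx : x ∈ U) (r : ℕ) (i j : Fin n) :
    MDifferentiableAt (𝓡 m) 𝓘(ℝ, ℝ) (fun y ↦ frameMatrix e (S.T nabla r) y i j) x := by
  refine (mdifferentiableAt_newtonMatrix
    (he.mdifferentiableAt_frameMatrix_shape nabla hU hx) r i j).congr_of_eventuallyEq ?_
  filter_upwards [hU.mem_nhds hx] with y hy
  rw [he.frameMatrix_T nabla r hy]

theorem IsFrame.transpose_frameMatrix_shape (he : S.IsFrame e U) (hU : IsOpen U) {y : M}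
    (hy : y ∈ U) :
    (frameMatrix e (S.shape nabla) y).transpose = frameMatrix e (S.shape nabla) y := by
  ext i j
  exact S.inner_shape_comm nabla hU (he.smooth i) (he.smooth j) hy

/-- The connection matrix `⟨∇_v e_k, e_l⟩` of a frame. -/
def connMatrix (e : Fin n → ∀ x : M, S.TF x) (x : M) (v : TangentSpace (𝓡 m) x) :
    Matrix (Fin n) (Fin n) ℝ :=
  Matrix.of fun l k ↦ inner ℝ (nabla.toFun (fun y ↦ (e k y : TangentSpace (𝓡 m) y)) x v)
    (e l x : TangentSpace (𝓡 m) x)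

/-- Metric compatibility, applied to `⟨e_k, e_l⟩`, which is constant near `x`. -/
theorem IsFrame.transpose_connMatrix (he : S.IsFrame e U) (hU : IsOpen U) {x : M} (hx : x ∈ U)
    (v : TangentSpace (𝓡 m) x) :
    (connMatrix nabla e x v).transpose = -connMatrix nabla e x v := by
  ext k l
  have h := nabla.mvfderiv_inner ((he.smooth k).mdifferentiableAt hU hx)
    ((he.smooth l).mdifferentiableAt hU hx) v
  have h1 : mvfderiv (𝓡 m) (fun y ↦ inner ℝ (e k y : TangentSpace (𝓡 m) y) (e l y)) x v = 0 := by
    have h2 : (fun y ↦ inner ℝ (e k y : TangentSpace (𝓡 m) y) (e l y)) =ᶠ[𝓝 x]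
        fun _ ↦ if k = l then (1 : ℝ) else 0 := by
      filter_upwards [hU.mem_nhds hx] with y hy
      exact orthonormal_iff_ite.1 (he.orthonormal y hy) k l
    rw [mvfderiv_congr_of_eventuallyEq h2, mvfderiv_const]
    rfl
  rw [h1, real_inner_comm _ (e k x : TangentSpace (𝓡 m) x)] at h
  simp only [connMatrix, Matrix.transpose_apply, Matrix.neg_apply, Matrix.of_apply]
  linarith

/-- The Leibniz rule for `Y = ∑ ⟨Y, e_k⟩ e_k`: in a frame, `∇^F = d + ω`. -/
theorem IsFrame.inner_nablaF (he : S.IsFrame e U) (hU : IsOpen U) {x : M} (hx : x ∈ U)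
    (X : ∀ x : M, S.TF x) {Y : ∀ x : M, S.TF x}
    (hf : ∀ k, MDifferentiableAt (𝓡 m) 𝓘(ℝ, ℝ) (fun y ↦ inner ℝ (Y y) (e k y)) x) (l : Fin n) :
    inner ℝ (S.nablaF nabla X Y x) (e l x) =
      mvfderiv (𝓡 m) (fun y ↦ inner ℝ (Y y) (e l y)) x (X x) +
        (connMatrix nabla e x (X x)).mulVec (fun k ↦ inner ℝ (Y x) (e k x)) l := by
  have he' := fun k ↦ (he.smooth k).mdifferentiableAt hU hx
  have h1 : nabla.toFun (fun y ↦ (Y y : TangentSpace (𝓡 m) y)) x =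
      nabla.toFun (fun y ↦ ∑ k, (inner ℝ (Y y) (e k y) : ℝ) • (e k y : TangentSpace (𝓡 m) y)) x := by
    refine nabla.congr_of_eventuallyEq (he.fieldDiffAt hU hx hf)
      (mdifferentiableAt_sum_smul hf he') ?_
    filter_upwards [hU.mem_nhds hx] with y hy
    exact he.coe_eq_sum hy (Y y)
  have h2 : ∀ k, inner ℝ (e k x : TangentSpace (𝓡 m) x) (e l x) = if k = l then (1 : ℝ) else 0 :=
    fun k ↦ orthonormal_iff_ite.1 (he.orthonormal x hx) k l
  rw [nablaF, inner_projF, h1, nabla.toFun_sum_smul hf he', Finset.sum_add_distrib, inner_add_left,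
    sum_inner, sum_inner, add_comm]
  congr 1
  · simp [real_inner_smul_left, h2]
  · refine Finset.sum_congr rfl fun k _ ↦ ?_
    rw [real_inner_smul_left, mul_comm]
    rfl

/-- The matrix of `∇^F_v B` in a frame. -/
def covMatrix (e : Fin n → ∀ x : M, S.TF x) (B : ∀ x : M, Module.End ℝ (S.TF x)) (x : M)
    (v : TangentSpace (𝓡 m) x) : Matrix (Fin n) (Fin n) ℝ :=
  matrixDeriv (frameMatrix e B) x v +
    (connMatrix nabla e x v * frameMatrix e B x - frameMatrix e B x * connMatrix nabla e x v)

/-- In `(d + ω)(BY) - B (d + ω) Y` the derivatives of `Y` cancel and `dB + [ω, B]` remains, so only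
the value of `Y` at `x` matters. -/
theorem IsFrame.inner_nablaEnd (he : S.IsFrame e U) (hU : IsOpen U) {x : M} (hx : x ∈ U)
    (X : ∀ x : M, S.TF x) {B : ∀ x : M, Module.End ℝ (S.TF x)} {Y : ∀ x : M, S.TF x}
    (hB : ∀ i j, MDifferentiableAt (𝓡 m) 𝓘(ℝ, ℝ) (fun y ↦ frameMatrix e B y i j) x)
    (hf : ∀ k, MDifferentiableAt (𝓡 m) 𝓘(ℝ, ℝ) (fun y ↦ inner ℝ (Y y) (e k y)) x) (l : Fin n) :
    inner ℝ (S.nablaEnd nabla X B Y x) (e l x) =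
      (covMatrix nabla e B x (X x)).mulVec (fun k ↦ inner ℝ (Y x) (e k x)) l := by
  have h1 : ∀ i, (fun y ↦ inner ℝ (B y (Y y)) (e i y)) =ᶠ[𝓝 x]
      fun y ↦ ∑ k, frameMatrix e B y i k * inner ℝ (Y y) (e k y) := fun i ↦ by
    filter_upwards [hU.mem_nhds hx] with y hy
    exact he.inner_apply B hy (Y y) i
  have hBY : ∀ i, MDifferentiableAt (𝓡 m) 𝓘(ℝ, ℝ) (fun y ↦ inner ℝ (B y (Y y)) (e i y)) x :=
    fun i ↦ (mdifferentiableAt_sum_mul (hB i) hf).congr_of_eventuallyEq (h1 i)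
  have h2 : mvfderiv (𝓡 m) (fun y ↦ inner ℝ (B y (Y y)) (e l y)) x (X x) =
      mvfderiv (𝓡 m) (fun y ↦ ∑ k, frameMatrix e B y l k * inner ℝ (Y y) (e k y)) x (X x) :=
    mvfderiv_congr_of_eventuallyEq (h1 l) _
  rw [nablaEnd, inner_sub_left, he.inner_nablaF nabla hU hx X hBY, he.inner_apply B hx,
    h2, mvfderiv_sum_mul (hB l) hf]
  have h3 : (fun k ↦ inner ℝ (S.nablaF nabla X Y x) (e k x)) =
      (fun k ↦ mvfderiv (𝓡 m) (fun y ↦ inner ℝ (Y y) (e k y)) x (X x)) +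
        (connMatrix nabla e x (X x)).mulVec (fun k ↦ inner ℝ (Y x) (e k x)) := by
    funext k
    exact he.inner_nablaF nabla hU hx X hf k
  have h4 : (fun k ↦ inner ℝ (B x (Y x)) (e k x)) =
      (frameMatrix e B x).mulVec (fun k ↦ inner ℝ (Y x) (e k x)) := by
    funext k
    exact he.inner_apply B hx _ k
  rw [h3, h4, covMatrix, Matrix.add_mulVec, Matrix.sub_mulVec, Matrix.mulVec_add,
    ← Matrix.mulVec_mulVec, ← Matrix.mulVec_mulVec, Finset.sum_add_distrib]
  simp only [Pi.add_apply, Pi.sub_apply]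
  have h5 : ∑ i, mvfderiv (𝓡 m) (fun y ↦ frameMatrix e B y l i) x (X x) *
      inner ℝ (Y x) (e i x) = (matrixDeriv (frameMatrix e B) x (X x : TangentSpace (𝓡 m) x)).mulVec
        (fun k ↦ inner ℝ (Y x) (e k x)) l := rfl
  have h6 : ∑ i, frameMatrix e B x l i *
      mvfderiv (𝓡 m) (fun y ↦ inner ℝ (Y y) (e i y)) x (X x) = (frameMatrix e B x).mulVec
        (fun k ↦ mvfderiv (𝓡 m) (fun y ↦ inner ℝ (Y y) (e k y)) x (X x)) l := rfl
  rw [h5, h6]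
  ring

end Structure

end FrameCalculus

/-! ### Codazzi equation and divergence of the Newton transformations. -/

section Divergence

variable {m : ℕ} {M : Type*} [TopologicalSpace M] [ChartedSpace (EuclideanSpace ℝ (Fin m)) M]
  [IsManifold (𝓡 m) ∞ M] [RiemannianBundle (fun x : M ↦ TangentSpace (𝓡 m) x)]
  [IsContMDiffRiemannianBundle (𝓡 m) ∞ (EuclideanSpace ℝ (Fin m))
    (fun x : M ↦ TangentSpace (𝓡 m) x)]

namespace Structure

variable {n : ℕ} {S : Structure m M n} {e : Fin n → ∀ x : M, S.TF x} {U : Set M}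
  (nabla : LeviCivita m M)

theorem nablaP_N (X : ∀ x : M, S.TF x) :
    S.nablaP nabla (fun y ↦ (X y : TangentSpace (𝓡 m) y)) S.N =
      fun y ↦ -(S.shape nabla y (X y) : TangentSpace (𝓡 m) y) := by
  funext y
  rw [coe_shape, neg_neg]
  rfl

/-- The Codazzi equation. -/
theorem IsFrame.curvOp_eq (he : S.IsFrame e U) (hU : IsOpen U) {X V : ∀ x : M, S.TF x}
    (hX : SmoothOn (fun x ↦ (X x : TangentSpace (𝓡 m) x)) U)
    (hV : SmoothOn (fun x ↦ (V x : TangentSpace (𝓡 m) x)) U) {x : M} (hx : x ∈ U) :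
    S.curvOp nabla X V x =
      S.nablaEnd nabla X (S.shape nabla) V x - S.nablaEnd nabla V (S.shape nabla) X x := by
  have key : ∀ Y Z : ∀ x : M, S.TF x, SmoothOn (fun x ↦ (Z x : TangentSpace (𝓡 m) x)) U →
      S.projF x (S.nablaP nabla (fun y ↦ (Y y : TangentSpace (𝓡 m) y))
        (S.nablaP nabla (fun y ↦ (Z y : TangentSpace (𝓡 m) y)) S.N) x) =
      -S.nablaF nabla Y (fun y ↦ S.shape nabla y (Z y)) x := by
    intro Y Z hZ
    rw [nablaP_N, nablaP, projF_P, nabla.toFun_neg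
      ((he.smoothOn_shape nabla hU hZ).mdifferentiableAt hU hx)]
    exact map_neg (S.projF x) _
  have hmem := S.isIntegrable_TF U _ _ hU hV hX (fun y _ ↦ (V y).2) (fun y _ ↦ (X y).2) x hx
  have hbr : S.projF x (S.nablaP nabla (VectorField.mlieBracket (𝓡 m)
      (fun y ↦ (V y : TangentSpace (𝓡 m) y)) (fun y ↦ (X y : TangentSpace (𝓡 m) y))) S.N x) =
      -S.shape nabla x (S.nablaF nabla V X x - S.nablaF nabla X V x) := by
    -- By torsion-freeness the left side is the `TF`-component of `[V, X]`, which is all of `[V, X]`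
    -- by integrability.
    have h1 : S.nablaF nabla V X x - S.nablaF nabla X V x = ⟨_, hmem⟩ := by
      rw [nablaF, nablaF, ← map_sub, ← nabla.mlieBracket_eq (hV.mdifferentiableAt hU hx)
        (hX.mdifferentiableAt hU hx)]
      exact S.projF_coe x ⟨_, hmem⟩
    rw [h1, shape_eq, neg_neg, nablaP, projF_P]
  have h0 : S.curvOp nabla X V x =
      S.projF x (S.nablaP nabla (fun y ↦ (V y : TangentSpace (𝓡 m) y))
        (S.nablaP nabla (fun y ↦ (X y : TangentSpace (𝓡 m) y)) S.N) x) -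
      S.projF x (S.nablaP nabla (fun y ↦ (X y : TangentSpace (𝓡 m) y))
        (S.nablaP nabla (fun y ↦ (V y : TangentSpace (𝓡 m) y)) S.N) x) -
      S.projF x (S.nablaP nabla (VectorField.mlieBracket (𝓡 m)
        (fun y ↦ (V y : TangentSpace (𝓡 m) y)) (fun y ↦ (X y : TangentSpace (𝓡 m) y))) S.N x) := by
    rw [← map_sub, ← map_sub]
    rfl
  rw [h0, key V X hX, key X V hV, hbr, map_sub, nablaEnd, nablaEnd]
  abel

theorem connMatrix_sum {x : M} {κ : Type*} [Fintype κ] (c : κ → ℝ)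
    (v : κ → TangentSpace (𝓡 m) x) :
    connMatrix nabla e x (∑ k, c k • v k) = ∑ k, c k • connMatrix nabla e x (v k) := by
  ext i j
  simp [connMatrix, Matrix.sum_apply, map_sum, sum_inner, real_inner_smul_left]

theorem covMatrix_sum (B : ∀ x : M, Module.End ℝ (S.TF x)) {x : M} {κ : Type*} [Fintype κ]
    (c : κ → ℝ) (v : κ → TangentSpace (𝓡 m) x) :
    covMatrix nabla e B x (∑ k, c k • v k) = ∑ k, c k • covMatrix nabla e B x (v k) := by
  have h : matrixDeriv (frameMatrix e B) x (∑ k, c k • v k) =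
      ∑ k, c k • matrixDeriv (frameMatrix e B) x (v k) := by
    ext i j
    simp [matrixDeriv, Matrix.sum_apply, map_sum]
  simp only [covMatrix, h, connMatrix_sum, smul_add, smul_sub, Finset.sum_add_distrib,
    Finset.sum_sub_distrib, Finset.sum_mul, Finset.mul_sum, Matrix.smul_mul, Matrix.mul_smul]

/-- The commutator of the skew `ω` with the symmetric matrix of `A` is symmetric. -/
theorem IsFrame.transpose_covMatrix_shape (he : S.IsFrame e U) (hU : IsOpen U) {x : M}
    (hx : x ∈ U) (v : TangentSpace (𝓡 m) x) :
    (covMatrix nabla e (S.shape nabla) x v).transpose = covMatrix nabla e (S.shape nabla) x v := by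
  have h : (matrixDeriv (frameMatrix e (S.shape nabla)) x v).transpose =
      matrixDeriv (frameMatrix e (S.shape nabla)) x v := by
    ext i j
    refine mvfderiv_congr_of_eventuallyEq ?_ v
    filter_upwards [hU.mem_nhds hx] with y hy
    exact congrFun (congrFun (he.transpose_frameMatrix_shape nabla hU hy) i) j
  rw [covMatrix, Matrix.transpose_add, Matrix.transpose_sub, Matrix.transpose_mul,
    Matrix.transpose_mul, h, he.transpose_connMatrix nabla hU hx,
    he.transpose_frameMatrix_shape nabla hU hx]
  simp only [Matrix.mul_neg, Matrix.neg_mul]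
  abel

/-- Both `d` and `[ω, ·]` are derivations, so `∇_v` differentiates the Newton recursion by the
product rule. -/
theorem IsFrame.covMatrix_T_succ (he : S.IsFrame e U) (hU : IsOpen U) {x : M} (hx : x ∈ U)
    (r : ℕ) (v : TangentSpace (𝓡 m) x) :
    covMatrix nabla e (S.T nabla (r + 1)) x v =
      (frameMatrix e (S.T nabla r) x * covMatrix nabla e (S.shape nabla) x v).trace • 1 -
        covMatrix nabla e (S.shape nabla) x v * frameMatrix e (S.T nabla r) x -
        frameMatrix e (S.shape nabla) x * covMatrix nabla e (S.T nabla r) x v := by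
  have hd : ∀ s, matrixDeriv (frameMatrix e (S.T nabla s)) x v =
      matrixDeriv (fun y ↦ newtonMatrix (frameMatrix e (S.shape nabla) y) s) x v := fun s ↦ by
    ext i j
    refine mvfderiv_congr_of_eventuallyEq ?_ v
    filter_upwards [hU.mem_nhds hx] with y hy
    rw [he.frameMatrix_T nabla s hy]
  have hcomm := newtonMatrix_commute (frameMatrix e (S.shape nabla) x) r
  simp only [covMatrix, hd, he.frameMatrix_T nabla _ hx]
  rw [matrixDeriv_newtonMatrix_succ (he.mdifferentiableAt_frameMatrix_shape nabla hU hx),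
    newtonMatrix]
  set a := frameMatrix e (S.shape nabla) x
  set t := newtonMatrix a r
  set w := connMatrix nabla e x v
  set a' := matrixDeriv (frameMatrix e (S.shape nabla)) x v
  -- Since `t` commutes with `a`, `tr (t [w, a]) = 0`: Jacobi's formula holds with `∇_v A` in place
  -- of `dA(v)`.
  have htr : (t * (a' + (w * a - a * w))).trace = (t * a').trace := by
    have h1 : (t * (a * w)).trace = (t * (w * a)).trace := by
      rw [← mul_assoc, ← hcomm, mul_assoc, Matrix.trace_mul_comm a, mul_assoc]
    rw [mul_add, mul_sub, Matrix.trace_add, Matrix.trace_sub, h1, sub_self, add_zero]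
  rw [htr]
  simp only [mul_sub, sub_mul, mul_add, add_mul, Matrix.smul_mul, Matrix.mul_smul, one_mul,
    mul_one, mul_assoc]
  abel

theorem IsFrame.mdifferentiableAt_inner_frame (he : S.IsFrame e U) (hU : IsOpen U) {x : M}
    (hx : x ∈ U) {X : ∀ x : M, S.TF x}
    (hX : SmoothOn (fun x ↦ (X x : TangentSpace (𝓡 m) x)) U) (k : Fin n) :
    MDifferentiableAt (𝓡 m) 𝓘(ℝ, ℝ) (fun y ↦ inner ℝ (X y) (e k y)) x :=
  mdifferentiableAt_inner (hX.mdifferentiableAt hU hx) ((he.smooth k).mdifferentiableAt hU hx)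

theorem IsFrame.inner_nablaEnd_frame (he : S.IsFrame e U) (hU : IsOpen U) {x : M} (hx : x ∈ U)
    (X : ∀ x : M, S.TF x) {B : ∀ x : M, Module.End ℝ (S.TF x)}
    (hB : ∀ i j, MDifferentiableAt (𝓡 m) 𝓘(ℝ, ℝ) (fun y ↦ frameMatrix e B y i j) x)
    (i l : Fin n) :
    inner ℝ (S.nablaEnd nabla X B (e i) x) (e l x) = covMatrix nabla e B x (X x) l i := by
  rw [he.inner_nablaEnd nabla hU hx X hB
    (he.mdifferentiableAt_inner_frame hU hx (he.smooth i))]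
  have h : (fun k ↦ (inner ℝ (e i x) (e k x) : ℝ)) = Pi.single i 1 := by
    funext k
    rw [orthonormal_iff_ite.1 (he.orthonormal x hx) i k, Pi.single_apply]
    simp [eq_comm]
  rw [h, Matrix.mulVec_single_one]
  rfl

theorem IsFrame.inner_divF (he : S.IsFrame e U) (hU : IsOpen U) {x : M} (hx : x ∈ U)
    {B : ∀ x : M, Module.End ℝ (S.TF x)}
    (hB : ∀ i j, MDifferentiableAt (𝓡 m) 𝓘(ℝ, ℝ) (fun y ↦ frameMatrix e B y i j) x)
    (u : S.TF x) :
    inner ℝ (S.divF nabla e B x) u =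
      ∑ l, inner ℝ u (e l x) * ∑ i, covMatrix nabla e B x (e i x) l i := by
  rw [← he.sum_inner_mul_inner hx]
  refine Finset.sum_congr rfl fun l _ ↦ ?_
  rw [divF, sum_inner, mul_comm]
  congr 1
  exact Finset.sum_congr rfl fun i _ ↦ he.inner_nablaEnd_frame nabla hU hx (e i) hB i l

/-- The trace of `T_r(A) ∘ R^P_X` in terms of the covariant derivatives of the shape operator. -/
theorem IsFrame.trF_T_curvOp (he : S.IsFrame e U) (hU : IsOpen U) {X : ∀ x : M, S.TF x}
    (hX : SmoothOn (fun x ↦ (X x : TangentSpace (𝓡 m) x)) U) (r : ℕ) {x : M} (hx : x ∈ U) :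
    S.trF e (fun V y ↦ S.T nabla r y (S.curvOp nabla X V y)) x =
      ∑ i, ∑ l, frameMatrix e (S.T nabla r) x i l *
        (∑ k, inner ℝ (X x) (e k x) * covMatrix nabla e (S.shape nabla) x (e k x) l i -
          (covMatrix nabla e (S.shape nabla) x (e i x)).mulVec
            (fun k ↦ inner ℝ (X x) (e k x)) l) := by
  have hA := he.mdifferentiableAt_frameMatrix_shape nabla hU hx
  refine Finset.sum_congr rfl fun i _ ↦ ?_
  rw [he.inner_apply _ hx]
  rw [Matrix.mulVec, dotProduct]
  refine Finset.sum_congr rfl fun l _ ↦ ?_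
  rw [he.curvOp_eq nabla hU hX (he.smooth i) hx, inner_sub_left,
    he.inner_nablaEnd_frame nabla hU hx X hA,
    he.inner_nablaEnd nabla hU hx (e i) hA (he.mdifferentiableAt_inner_frame hU hx hX)]
  congr 1
  -- The direction `X` is expanded in the frame, as `∇_v A` is linear in `v`.
  conv_lhs => rw [he.coe_eq_sum hx (X x), covMatrix_sum]
  simp [Matrix.sum_apply]

/-- The recursion for the leafwise divergence of the Newton transformations. -/
theorem IsFrame.inner_divF_T_succ (he : S.IsFrame e U) (hU : IsOpen U) {X : ∀ x : M, S.TF x}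
    (hX : SmoothOn (fun x ↦ (X x : TangentSpace (𝓡 m) x)) U) (r : ℕ) {x : M} (hx : x ∈ U) :
    inner ℝ (S.divF nabla e (S.T nabla (r + 1)) x) (X x) =
      -inner ℝ (S.divF nabla e (S.T nabla r) x) (S.shape nabla x (X x)) +
        S.trF e (fun V y ↦ S.T nabla r y (S.curvOp nabla X V y)) x := by
  have hT := he.mdifferentiableAt_frameMatrix_T nabla hU hx
  have ha := he.transpose_frameMatrix_shape nabla hU hx
  rw [he.inner_divF nabla hU hx (hT (r + 1)), he.inner_divF nabla hU hx (hT r),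
    he.trF_T_curvOp nabla hU hX r hx]
  simp only [he.inner_apply (S.shape nabla) hx (X x)]
  refine sum_divergence_step _ _ (fun i ↦ covMatrix nabla e (S.shape nabla) x (e i x))
    (fun i ↦ covMatrix nabla e (S.T nabla r) x (e i x))
    (fun i ↦ covMatrix nabla e (S.T nabla (r + 1)) x (e i x)) _ ha ?_
    (fun i ↦ he.transpose_covMatrix_shape nabla hU hx _)
    (fun i ↦ he.covMatrix_T_succ nabla hU hx r _)
  rw [he.frameMatrix_T nabla r hx]
  exact transpose_newtonMatrix ha r

theorem divF_T_zero (x : M) : S.divF nabla e (S.T nabla 0) x = 0 := by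
  refine Finset.sum_eq_zero fun i _ ↦ ?_
  simp only [nablaEnd, T, newton, Module.End.one_apply]
  exact sub_self _

/-- Induction on `r` with `X` general: the trace term of the recursion is the summand `j = 0`, and
the induction hypothesis for `AX` gives the others with one more power of `A` and the opposite sign.
-/
theorem IsFrame.inner_divF_T_eq_sum (he : S.IsFrame e U) (hU : IsOpen U) (r : ℕ) {x : M}
    (hx : x ∈ U) (X : ∀ x : M, S.TF x)
    (hX : SmoothOn (fun x ↦ (X x : TangentSpace (𝓡 m) x)) U) :
    inner ℝ (S.divF nabla e (S.T nabla r) x) (X x) =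
      ∑ j ∈ Finset.range r, (-1 : ℝ) ^ j *
        S.trF e (fun V y ↦ S.T nabla (r - (j + 1)) y
          (S.curvOp nabla (fun z ↦ (S.shape nabla z ^ j) (X z)) V y)) x := by
  induction r generalizing X with
  | zero => rw [divF_T_zero, inner_zero_left, Finset.range_zero, Finset.sum_empty]
  | succ r ih =>
    rw [he.inner_divF_T_succ nabla hU hX r hx, Finset.sum_range_succ',
      ih (fun z ↦ S.shape nabla z (X z)) (he.smoothOn_shape nabla hU hX),
      ← Finset.sum_neg_distrib]
    congr 1
    · refine Finset.sum_congr rfl fun j _ ↦ ?_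
      simp only [pow_succ (S.shape nabla _), Module.End.mul_apply, Nat.add_sub_add_right]
      rw [pow_succ]
      ring
    · simp

end Structure

end Divergence

end FoliatedSubRiemannian

end

theorem mainTheorem5 {m n : ℕ} {M : Type*} [TopologicalSpace M]
    [ChartedSpace (EuclideanSpace ℝ (Fin m)) M] [IsManifold (𝓡 m) ∞ M]
    [RiemannianBundle (fun x : M ↦ TangentSpace (𝓡 m) x)]
    [IsContMDiffRiemannianBundle (𝓡 m) ∞ (EuclideanSpace ℝ (Fin m))
      (fun x : M ↦ TangentSpace (𝓡 m) x)]
    (S : FoliatedSubRiemannian.Structure m M n) (nabla : FoliatedSubRiemannian.LeviCivita m M)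
    (U : Set M) (hU : IsOpen U) (e : Fin n → ∀ x : M, S.TF x) (he : S.IsFrame e U) :
    (∀ x ∈ U, S.divF nabla e (S.T nabla 0) x = 0) ∧
    (∀ X : ∀ x : M, S.TF x,
      FoliatedSubRiemannian.SmoothOn (fun x ↦ (X x : TangentSpace (𝓡 m) x)) U →
      ∀ r : ℕ, 0 < r → ∀ x ∈ U,
        inner ℝ (S.divF nabla e (S.T nabla r) x) (X x) =
          -inner ℝ (S.divF nabla e (S.T nabla (r - 1)) x) (S.shape nabla x (X x)) +
            S.trF e (fun V y ↦ S.T nabla (r - 1) y (S.curvOp nabla X V y)) x) ∧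
    (∀ X : ∀ x : M, S.TF x,
      FoliatedSubRiemannian.SmoothOn (fun x ↦ (X x : TangentSpace (𝓡 m) x)) U →
      ∀ r : ℕ, 0 < r → ∀ x ∈ U,
        inner ℝ (S.divF nabla e (S.T nabla r) x) (X x) =
          ∑ j ∈ Finset.Icc 1 r, (-1 : ℝ) ^ (j - 1) *
            S.trF e (fun V y ↦ S.T nabla (r - j) y
              (S.curvOp nabla (fun z ↦ (S.shape nabla z ^ (j - 1)) (X z)) V y)) x) := by
  refine ⟨fun x _ ↦ FoliatedSubRiemannian.Structure.divF_T_zero nabla x, fun X hX r hr x hx ↦ ?_,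
    fun X hX r hr x hx ↦ ?_⟩
  · obtain ⟨r, rfl⟩ := Nat.exists_eq_succ_of_ne_zero hr.ne'
    exact he.inner_divF_T_succ nabla hU hX r hx
  · rw [he.inner_divF_T_eq_sum nabla hU r hx X hX]
    -- The sum over `0 ≤ j < r` is reindexed by `j + 1` to run over `1, …, r`.
    refine Finset.sum_nbij' (· + 1) (· - 1) ?_ ?_ ?_ ?_ fun j _ ↦ by rw [Nat.add_sub_cancel]
    all_goals
      intro j hj
      simp only [Finset.mem_range, Finset.mem_Icc] at hj ⊢
      omega
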